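/- Let $d\ge 2$, let $e_1,\dots,e_d$ be the standard unit vectors of $\mathbb{Z}^d$, and put $\mathcal{E}_+=\{e_1,\dots,e_d\}$ and $\mathcal{E}=\{\pm e_1,\dots,\pm e_d\}$. Let $k\ge 1$, let $E_1,\dots,E_k$ be sets with $e_1\in E_i\subset\mathcal{E}_+$ for every $i$, and let $r_1,\dots,r_k\ge 0$ with $\sum_{i=1}^k r_i=1$. Let $(U_x)_{x\in\mathbb{Z}^d}$, $(U'_x)_{x\in\mathbb{Z}^d}$ be i.i.d. random variables, uniform on $(0,1]$, on some probability space. For $p\in[0,1]$ and $x\in\mathbb{Z}^d$ set $\mathcal{G}_x=E_i$ if $U_x<p$ and $U'_x\in\big[\sum_{j<i}r_j,\sum_{j\le i}r_j\big)$, and $\mathcal{G}_x=\mathcal{E}$ if $U_x\ge p$ (the null event $\{U'_x=1\}$ being irrelevant). Insert an arrow from each $x$ to each $x+e$, $e\in\mathcal{G}_x$. Let $\mathcal{C}_x$ be the set of vertices that can be reached from $x$ by following arrows (including $x$), let $\mathcal{B}_x=\{y:x\in\mathcal{C}_y\}$, let $o$ be the origin, and let $$L_x=\inf\{n\in\mathbb{Z}:x+ne_1\in\mathcal{C}_o\},\qquad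 R_x=\sup\{n\in\mathbb{Z}:x+ne_1\in\mathcal{B}_o\}\in[-\infty,\infty].$$ Then there is a number $p_c\in(0,1)$, depending only on $d$, $(E_1,\dots,E_k)$ and $(r_1,\dots,r_k)$, which is the critical point of the forward cluster, that is, - if $0\le p<p_c$ then $\mathcal{C}_o=\mathbb{Z}^d$ almost surely, and - if $p_c<p<1$ then, almost surely, $L_x$ is finite for every $x\in\mathbb{Z}^d$; and the backward cluster has its phase transition at the same $p_c$: - if $0\le p<p_c$ then $\mathcal{B}_o=\mathbb{Z}^d$ almost surely, and - if $p_c<p<1$ then, almost surely, $R_x$ is finite for every $x\in\mathbb{Z}^d$. -/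

import Mathlib

open MeasureTheory ProbabilityTheory Set

namespace HalfOrthant

/-- The first unit vector `e₁` of `ℤ^d` (coordinates are indexed by `Fin d`, from `0`). -/
def e1 (d : ℕ) [NeZero d] : Fin d → ℤ := Pi.single 0 1

/-- The set `ℰ₊ = {e₁, …, e_d}` of positive unit vectors of `ℤ^d`. -/
def posUnits (d : ℕ) : Set (Fin d → ℤ) := {e | ∃ i : Fin d, e = Pi.single i 1}

/-- The set `ℰ = {±e₁, …, ±e_d}` of all unit vectors of `ℤ^d`. -/
def units (d : ℕ) : Set (Fin d → ℤ) :=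
  {e | ∃ i : Fin d, e = Pi.single i 1 ∨ e = -Pi.single i 1}

/-- The simplex `𝒟_k` of probability vectors of length `k`. -/
def simplex (k : ℕ) : Set (Fin k → ℝ) := {r | (∀ i, 0 ≤ r i) ∧ ∑ i, r i = 1}

/-- `u` lies in the `i`-th interval `[r₁ + ⋯ + r_{i-1}, r₁ + ⋯ + r_i)`. -/
def InSlot {k : ℕ} (r : Fin k → ℝ) (i : Fin k) (u : ℝ) : Prop :=
  ∑ j ∈ Finset.Iio i, r j ≤ u ∧ u < ∑ j ∈ Finset.Iic i, r j

/-- The local environment determined by the values `u`, `u'` of the two uniform variables at a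
site: it is `E i` if `u < p` and `u'` is in the `i`-th interval of `r`, and `F i` if `p ≤ u` and
`u'` is in the `i`-th interval of `q`. (It is empty if `u'` is in none of the intervals, an event
of probability zero.) -/
def localEnv {d k l : ℕ} (E : Fin k → Set (Fin d → ℤ)) (F : Fin l → Set (Fin d → ℤ))
    (r : Fin k → ℝ) (q : Fin l → ℝ) (p u u' : ℝ) : Set (Fin d → ℤ) :=
  {e | (u < p ∧ ∃ i, InSlot r i u' ∧ e ∈ E i) ∨ (p ≤ u ∧ ∃ i, InSlot q i u' ∧ e ∈ F i)}

/-- The environment `(𝒢_x)` of the model in which every `F` site has the environment `ℰ`, that is,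
`ℓ = 1` and `F₁ = ℰ` (so that `q₁ = 1`), for the realisations `u`, `u'` of the uniform variables. -/
def env {d k : ℕ} (E : Fin k → Set (Fin d → ℤ)) (r : Fin k → ℝ) (p : ℝ)
    (u u' : (Fin d → ℤ) → ℝ) (x : Fin d → ℤ) : Set (Fin d → ℤ) :=
  localEnv E (fun _ : Fin 1 => units d) r (fun _ : Fin 1 => 1) p (u x) (u' x)

/-- The forward cluster `𝒞_x`: the vertices that can be reached from `x` by following the arrows
`y → y + e`, `e ∈ G y`. -/
def forwardCluster {d : ℕ} (G : (Fin d → ℤ) → Set (Fin d → ℤ)) (x : Fin d → ℤ) :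
    Set (Fin d → ℤ) :=
  {y | Relation.ReflTransGen (fun a b => ∃ e ∈ G a, b = a + e) x y}

/-- The backward cluster `ℬ_x`: the vertices from which `x` can be reached. -/
def backwardCluster {d : ℕ} (G : (Fin d → ℤ) → Set (Fin d → ℤ)) (x : Fin d → ℤ) :
    Set (Fin d → ℤ) :=
  {y | x ∈ forwardCluster G y}

/-- `L_x = inf {k ∈ ℤ : x + k e₁ ∈ 𝒞_o}`, an extended integer (`⊤` if the set is empty). -/
noncomputable def leftmost {d : ℕ} [NeZero d] (G : (Fin d → ℤ) → Set (Fin d → ℤ))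
    (x : Fin d → ℤ) : EReal :=
  ⨅ k ∈ {k : ℤ | x + k • e1 d ∈ forwardCluster G 0}, ((k : ℝ) : EReal)

/-- `R_x = sup {k ∈ ℤ : x + k e₁ ∈ ℬ_o}`, an extended integer (`⊥` if the set is empty). -/
noncomputable def rightmost {d : ℕ} [NeZero d] (G : (Fin d → ℤ) → Set (Fin d → ℤ))
    (x : Fin d → ℤ) : EReal :=
  ⨆ k ∈ {k : ℤ | x + k • e1 d ∈ backwardCluster G 0}, ((k : ℝ) : EReal)

/-- `(U_x)` and `(U'_x)`, `x ∈ ℤ^d`, together form an i.i.d. family of random variables that are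
uniform on `(0, 1]`. -/
structure IsUniformSystem {d : ℕ} {Ω : Type*} [MeasurableSpace Ω] (P : Measure Ω)
    (U U' : (Fin d → ℤ) → Ω → ℝ) : Prop where
  measurable_left : ∀ x, Measurable (U x)
  measurable_right : ∀ x, Measurable (U' x)
  law_left : ∀ x, P.map (U x) = volume.restrict (Ioc (0 : ℝ) 1)
  law_right : ∀ x, P.map (U' x) = volume.restrict (Ioc (0 : ℝ) 1)
  indep : iIndepFun (Sum.elim U U') P

end HalfOrthant

/-!
The environment decreases, and with it the forward cluster, as `p` grows, so `pc` can be taken to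
be the supremum of the `p` for which `𝒞_o = ℤ^d` almost surely. Two facts make this the critical
point of both clusters.

*Zero-one laws.* Every site carries the arrow `e₁`, so `𝒞_{e₁} ⊆ 𝒞_o` and `ℬ_o ⊆ ℬ_{e₁}`. Hence the
events `{𝒞_o = ℤ^d}` and `{ℬ_o = ℤ^d}` are invariant, up to null sets, under the translation by
`e₁`; this translation acts ergodically on the i.i.d. family (`ergodic_comp_perm`), so both events
have probability `0` or `1`. By translation invariance each of them has probability `1` if and only
if almost surely every vertex can be reached from every other one, so they have the same probability
(`ae_forwardCluster_iff_backwardCluster`). If `p < 1`, then every half-line parallel to `e₁`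
contains a site with all arrows. Therefore a cluster that contains a whole line parallel to `e₁`
also contains the neighbouring lines, and hence everything; and a cluster that is not everything has
finite `L_x`, respectively `R_x`, for every `x` (`IsGood.leftmost_ne`, `IsGood.rightmost_ne`).

*Nontriviality.* For `p` near `1` a path-counting argument shows that `-e₁ ∉ 𝒞_o` with positive
probability, since about half of the steps of a self-avoiding path from `o` to `-e₁` are negative
and each of these needs a site with `p ≤ U` (`exists_not_ae_forwardCluster_eq_univ`). For `p` small,
if `𝒞_o` is not everything, then the leftmost points `L y` of `𝒞_o` in the rows of the plane spanned
by `e₁` and `e₂` form an infinite profile; row `y` then contains at least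
`max 1 (L (y ± 1) - L y)` sites with `U < p`. The sum over all profiles with `m` increments and a
given starting point decays exponentially in `m`, so that almost surely there is no such profile
(`ae_forwardCluster_eq_univ`).
-/

namespace HalfOrthant

/-! ### Ergodicity of Bernoulli shifts -/

section Ergodicity
open Measure
variable {ι X : Type*} [MeasurableSpace X] (ν : Measure X) [IsProbabilityMeasure ν]

/-- An i.i.d. family is invariant in law under permutations of its index set. -/
theorem measurePreserving_comp_perm (σ : Equiv.Perm ι) :
    MeasurePreserving (fun (ω : ι → X) i => ω (σ i))
      (infinitePi fun _ => ν) (infinitePi fun _ => ν) := by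
  classical
  refine ⟨by fun_prop, eq_infinitePi _ fun s t ht => ?_⟩
  have hmeas : MeasurableSet (Set.pi (s : Set ι) t) :=
    MeasurableSet.pi s.countable_toSet fun i _ => ht i
  have hpre : (fun (ω : ι → X) i => ω (σ i)) ⁻¹' Set.pi (s : Set ι) t =
      Set.pi ((s.map σ.toEmbedding : Finset ι) : Set ι) (fun i => t (σ.symm i)) := by
    ext ω
    simp only [Set.mem_pi, mem_preimage, Finset.mem_coe, Finset.mem_map_equiv]
    exact ⟨fun h i hi => by simpa using h _ hi, fun h i hi => by simpa using h (σ i) (by simpa)⟩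
  rw [map_apply (by fun_prop) hmeas, hpre, infinitePi_pi _ (fun i _ => ht _), Finset.prod_map]
  simp

/-- Two cylinder events with disjoint bases are independent; here the second one is obtained
from the first one by a permutation of the coordinates. -/
theorem measure_cylinder_inter_perm (τ : Equiv.Perm ι) (I : Finset ι) (S : Set (I → X))
    (hS : MeasurableSet S) (hd : ∀ i ∈ I, τ i ∉ I) :
    infinitePi (fun _ => ν) (cylinder I S ∩ (fun (ω : ι → X) i => ω (τ i)) ⁻¹' cylinder I S) =
      infinitePi (fun _ => ν) (cylinder I S) * infinitePi (fun _ => ν) (cylinder I S) := by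
  classical
  set μ := infinitePi (fun _ : ι => ν)
  have hpre : μ ((fun (ω : ι → X) i => ω (τ i)) ⁻¹' cylinder I S) = μ (cylinder I S) :=
    (measurePreserving_comp_perm ν τ).measure_preimage
      (hS.cylinder I).nullMeasurableSet
  have hind : iIndepFun (fun (i : ι) (ω : ι → X) => ω i) μ :=
    iIndepFun_infinitePi (X := fun (_ : ι) (x : X) => x) (fun _ => measurable_id)
  have hdisj : Disjoint I (I.map τ.toEmbedding) := by
    rw [Finset.disjoint_right]
    intro j hj
    obtain ⟨i, hi, rfl⟩ := Finset.mem_map.1 hj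
    exact hd i hi
  have h2 := hind.indepFun_finset I (I.map τ.toEmbedding) hdisj (fun i => measurable_pi_apply i)
  let S' : Set (I.map τ.toEmbedding → X) :=
    (fun x (i : I) => x ⟨τ i, Finset.mem_map_of_mem _ i.2⟩) ⁻¹' S
  have hS' : MeasurableSet S' := by
    refine hS.preimage ?_
    fun_prop
  have := h2.measure_inter_preimage_eq_mul S S' hS hS'
  exact this.trans (congrArg (μ (cylinder I S) * ·) hpre)

/-- A Bernoulli shift is ergodic as soon as the iterates of the permutation move every finite set
off itself: an invariant event is approximated by a cylinder event, which is independent of one of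
its translates, so its probability `a` satisfies `a = a ^ 2`. -/
theorem ergodic_comp_perm (σ : Equiv.Perm ι)
    (hσ : ∀ I : Finset ι, ∃ n : ℕ, ∀ i ∈ I, (σ ^ n) i ∉ I) :
    Ergodic (fun (ω : ι → X) i => ω (σ i)) (infinitePi fun _ => ν) := by
  refine ⟨measurePreserving_comp_perm ν σ, ⟨fun A hA hinv => ?_⟩⟩
  set μ := infinitePi (fun _ : ι => ν) with hμ
  have hiter : ∀ n : ℕ, (fun (ω : ι → X) i => ω ((σ ^ n) i)) ⁻¹' A = A := by
    intro n
    induction n with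
    | zero => rfl
    | succ n ih =>
      conv_rhs => rw [← ih, ← hinv]
      rw [← preimage_comp]
      congr 1
  have hdense : μ.MeasureDense (measurableCylinders fun _ : ι => X) :=
    MeasureDense.of_generateFrom_isSetAlgebra_finite (μ := μ)
      { empty_mem := empty_mem_measurableCylinders _
        compl_mem := fun _ => compl_mem_measurableCylinders
        union_mem := fun _ _ => union_mem_measurableCylinders } generateFrom_measurableCylinders.symm
  have key : ∀ ε : ℝ, 0 < ε → |μ.real A - μ.real A ^ 2| ≤ 4 * ε := by
    intro ε hε
    obtain ⟨t, ht, hAt⟩ := hdense.approx A hA (measure_ne_top _ _) ε hε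
    have htm : MeasurableSet t := hdense.measurable t ht
    obtain ⟨I, S, hS, rfl⟩ := (mem_measurableCylinders t).1 ht
    obtain ⟨n, hn⟩ := hσ I
    set t := cylinder (α := fun _ : ι => X) I S
    set θ := fun (ω : ι → X) i => ω ((σ ^ n) i)
    have hmul : μ.real (t ∩ θ ⁻¹' t) = μ.real t ^ 2 := by
      rw [measureReal_def, measure_cylinder_inter_perm ν (σ ^ n) I S hS hn, ENNReal.toReal_mul, sq]
      rfl
    have hAt' : μ (symmDiff A (θ ⁻¹' t)) < ENNReal.ofReal ε := by
      have h := (measurePreserving_comp_perm ν (σ ^ n)).measure_preimage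
        (hA.symmDiff htm).nullMeasurableSet
      rw [preimage_symmDiff, hiter n] at h
      rw [h]; exact hAt
    have r1 : μ.real (symmDiff A t) < ε := ENNReal.toReal_lt_of_lt_ofReal hAt
    have r2 : μ.real (symmDiff A (θ ⁻¹' t)) < ε := ENNReal.toReal_lt_of_lt_ofReal hAt'
    have b1 : |μ.real A - μ.real t| ≤ μ.real (symmDiff A t) :=
      abs_measureReal_sub_le_measureReal_symmDiff hA.nullMeasurableSet htm.nullMeasurableSet
    have hθt : MeasurableSet (θ ⁻¹' t) := htm.preimage (by fun_prop)
    have b2 : |μ.real A - μ.real (t ∩ θ ⁻¹' t)| ≤ μ.real (symmDiff A (t ∩ θ ⁻¹' t)) :=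
      abs_measureReal_sub_le_measureReal_symmDiff hA.nullMeasurableSet
        (htm.inter hθt).nullMeasurableSet
    have b3 : μ.real (symmDiff A (t ∩ θ ⁻¹' t)) ≤
        μ.real (symmDiff A t) + μ.real (symmDiff A (θ ⁻¹' t)) := by
      refine (measureReal_mono ?_).trans (measureReal_union_le _ _)
      intro ω hω
      simp only [mem_symmDiff, mem_inter_iff, mem_union] at hω ⊢
      tauto
    rw [hmul] at b2
    have ha : 0 ≤ μ.real A := measureReal_nonneg
    have ha1 : μ.real A ≤ 1 := measureReal_le_one
    have hb : 0 ≤ μ.real t := measureReal_nonneg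
    have hb1 : μ.real t ≤ 1 := measureReal_le_one
    have b4 : |μ.real A - μ.real t| < ε := b1.trans_lt r1
    have b5 : |μ.real A - μ.real t ^ 2| < 2 * ε := by linarith
    rw [abs_lt] at b4 b5
    rw [abs_le]
    constructor <;> nlinarith
  have hsq : μ.real A - μ.real A ^ 2 = 0 := by
    rw [← abs_eq_zero]
    refine le_antisymm (le_of_forall_pos_le_add fun ε hε => ?_) (abs_nonneg _)
    have := key (ε / 4) (by positivity)
    linarith
  have h01 : μ.real A = 0 ∨ μ.real A = 1 := by
    have : μ.real A * (1 - μ.real A) = 0 := by linarith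
    rcases mul_eq_zero.1 this with h | h
    · exact Or.inl h
    · right; linarith
  rw [Filter.eventuallyConst_set']
  rcases h01 with h | h
  · left
    rw [measureReal_eq_zero_iff] at h
    exact ae_eq_empty.2 h
  · right
    rw [ae_eq_univ, prob_compl_eq_zero_iff hA]
    rw [measureReal_def] at h
    exact (ENNReal.toReal_eq_one_iff _).1 h

end Ergodicity

/-! ### Clusters in a fixed environment -/

section Deterministic
variable {d : ℕ}

/-- A nonempty set of vertices that is closed under unit steps contains every vertex. -/
theorem mem_of_add_units_mem {T : Set (Fin d → ℤ)} {a : Fin d → ℤ} (ha : a ∈ T)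
    (hT : ∀ y ∈ T, ∀ e ∈ units d, y + e ∈ T) (v : Fin d → ℤ) : v ∈ T := by
  let M : AddSubmonoid (Fin d → ℤ) :=
    { carrier := {v | ∀ y ∈ T, y + v ∈ T}
      zero_mem' := fun y hy => by simpa using hy
      add_mem' := fun {v w} hv hw y hy => by
        rw [← add_assoc]; exact hw _ (hv _ hy) }
  have hM : ∀ v : Fin d → ℤ, v ∈ M := by
    intro v
    rw [← Finset.univ_sum_single v]
    refine sum_mem fun i _ => ?_
    obtain ⟨n, hn | hn⟩ := (v i).eq_nat_or_neg
    · have h : Pi.single i (v i) = n • (Pi.single i 1 : Fin d → ℤ) := by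
        rw [hn, ← Pi.single_smul]; simp
      rw [h]
      exact M.nsmul_mem
        (fun y hy => hT y hy _ ⟨i, Or.inl rfl⟩) n
    · have h : Pi.single i (v i) = n • (-Pi.single i 1 : Fin d → ℤ) := by
        rw [hn, ← Pi.single_neg, ← Pi.single_smul]; simp
      rw [h]
      exact M.nsmul_mem
        (fun y hy => hT y hy _ ⟨i, Or.inr rfl⟩) n
  have := hM (v - a) a ha
  simpa using this

theorem neg_mem_units {e : Fin d → ℤ} (he : e ∈ units d) : -e ∈ units d := by
  obtain ⟨i, rfl | rfl⟩ := he
  · exact ⟨i, Or.inr rfl⟩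
  · exact ⟨i, Or.inl (neg_neg _)⟩

variable {G : (Fin d → ℤ) → Set (Fin d → ℤ)} {x y : Fin d → ℤ}

theorem add_mem_forwardCluster {e : Fin d → ℤ} (hy : y ∈ forwardCluster G x) (he : e ∈ G y) :
    y + e ∈ forwardCluster G x :=
  Relation.ReflTransGen.tail hy ⟨e, he, rfl⟩

theorem mem_backwardCluster_of_add {e : Fin d → ℤ} (he : e ∈ G y)
    (hy : y + e ∈ backwardCluster G x) : y ∈ backwardCluster G x :=
  Relation.ReflTransGen.head ⟨e, he, rfl⟩ hy

variable [NeZero d]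

/-- The almost sure properties of the environment that the geometric arguments use: the arrow
`e₁` is always present, and every half-line parallel to `e₁` contains a site from which all
arrows emanate. -/
structure IsGood (G : (Fin d → ℤ) → Set (Fin d → ℤ)) : Prop where
  e1_mem : ∀ x, e1 d ∈ G x
  exists_right : ∀ x, ∃ n : ℕ, units d ⊆ G (x + (n : ℤ) • e1 d)
  exists_left : ∀ x, ∃ n : ℕ, units d ⊆ G (x - (n : ℤ) • e1 d)

theorem forwardCluster_mono_e1 (h1 : ∀ x, e1 d ∈ G x) {m n : ℤ} (hmn : m ≤ n)
    (h : y + m • e1 d ∈ forwardCluster G x) : y + n • e1 d ∈ forwardCluster G x := by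
  induction n, hmn using Int.leInduction with
  | base => exact h
  | succ n _ ih =>
    have := add_mem_forwardCluster ih (h1 _)
    rwa [add_assoc, ← add_one_zsmul] at this

theorem backwardCluster_anti_e1 (h1 : ∀ x, e1 d ∈ G x) {m n : ℤ} (hmn : m ≤ n)
    (h : y + n • e1 d ∈ backwardCluster G x) : y + m • e1 d ∈ backwardCluster G x := by
  induction m, hmn using Int.leInductionDown with
  | base => exact h
  | pred n _ ih =>
    refine mem_backwardCluster_of_add (h1 _) ?_
    rwa [add_assoc, ← add_one_zsmul, sub_add_cancel]

theorem IsGood.exists_mem_forwardCluster (hG : IsGood G) (x y : Fin d → ℤ) :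
    ∃ n : ℤ, y + n • e1 d ∈ forwardCluster G x := by
  have : ∀ y, y ∈ {y | ∃ n : ℤ, y + n • e1 d ∈ forwardCluster G x} := by
    refine mem_of_add_units_mem (a := x) ⟨0, by
      rw [zero_smul, add_zero]; exact Relation.ReflTransGen.refl⟩ ?_
    rintro y ⟨n, hn⟩ e he
    obtain ⟨m, hm⟩ := hG.exists_right (y + n • e1 d)
    refine ⟨n + m, ?_⟩
    rw [add_assoc, ← add_zsmul] at hm
    have := add_mem_forwardCluster
      (forwardCluster_mono_e1 hG.e1_mem (by lia : n ≤ n + m) hn) (hm he)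
    rwa [add_right_comm] at this
  exact this y

theorem IsGood.exists_mem_backwardCluster (hG : IsGood G) (x y : Fin d → ℤ) :
    ∃ n : ℤ, y + n • e1 d ∈ backwardCluster G x := by
  have : ∀ y, y ∈ {y | ∃ n : ℤ, y + n • e1 d ∈ backwardCluster G x} := by
    refine mem_of_add_units_mem (a := x) ⟨0, by
      rw [zero_smul, add_zero]; exact Relation.ReflTransGen.refl⟩ ?_
    rintro y ⟨n, hn⟩ e he
    obtain ⟨m, hm⟩ := hG.exists_left (y + e + n • e1 d)
    refine ⟨n - m, ?_⟩
    rw [add_sub_assoc, ← sub_smul] at hm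
    refine mem_backwardCluster_of_add (hm (neg_mem_units he)) ?_
    have := backwardCluster_anti_e1 hG.e1_mem (by lia : n - m ≤ n) hn
    convert this using 1
    abel
  exact this y

/-- If the cluster contains an entire line parallel to `e₁`, then it passes to all neighbouring
lines through sites that lie arbitrarily far to the left, and so it is everything. -/
theorem IsGood.forwardCluster_eq_univ (hG : IsGood G)
    (h : ∀ n : ℤ, y + n • e1 d ∈ forwardCluster G x) : forwardCluster G x = univ := by
  have : ∀ z, z ∈ {y | ∀ n : ℤ, y + n • e1 d ∈ forwardCluster G x} := by
    refine mem_of_add_units_mem (a := y) h ?_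
    intro y hy e he n
    obtain ⟨m, hm⟩ := hG.exists_left (y + n • e1 d)
    rw [add_sub_assoc, ← sub_smul] at hm
    have := add_mem_forwardCluster (hy _) (hm he)
    rw [add_right_comm] at this
    exact forwardCluster_mono_e1 hG.e1_mem (by lia : n - m ≤ n) this
  exact eq_univ_of_forall fun z => by simpa using this z 0

/-- The same for backward clusters: sites far to the right on the neighbouring lines lead into the
line. -/
theorem IsGood.backwardCluster_eq_univ (hG : IsGood G)
    (h : ∀ n : ℤ, y + n • e1 d ∈ backwardCluster G x) : backwardCluster G x = univ := by
  have : ∀ z, z ∈ {y | ∀ n : ℤ, y + n • e1 d ∈ backwardCluster G x} := by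
    refine mem_of_add_units_mem (a := y) h ?_
    intro y hy e he n
    obtain ⟨m, hm⟩ := hG.exists_right (y + e + n • e1 d)
    rw [add_assoc, ← add_zsmul] at hm
    refine backwardCluster_anti_e1 hG.e1_mem (by lia : n ≤ n + m) ?_
    refine mem_backwardCluster_of_add (hm (neg_mem_units he)) ?_
    convert hy (n + m) using 1
    abel
  exact eq_univ_of_forall fun z => by simpa using this z 0

/-- `leftmost` is `⊥` only if a whole line lies in the cluster, and `⊤` only if a line parallel to
`e₁` misses the cluster. -/
theorem IsGood.leftmost_ne (hG : IsGood G) (h : forwardCluster G 0 ≠ univ) (x : Fin d → ℤ) :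
    leftmost G x ≠ ⊥ ∧ leftmost G x ≠ ⊤ := by
  constructor
  · intro hbot
    refine h (hG.forwardCluster_eq_univ (y := x) fun n => ?_)
    by_contra hn
    have hle : ((n : ℝ) : EReal) ≤ leftmost G x := by
      refine le_iInf₂ fun k hk => ?_
      by_contra! hlt
      have hkn : k ≤ n := by exact_mod_cast hlt.le
      exact hn (forwardCluster_mono_e1 hG.e1_mem hkn hk)
    rw [hbot, le_bot_iff] at hle
    exact EReal.coe_ne_bot _ hle
  · obtain ⟨n, hn⟩ := hG.exists_mem_forwardCluster 0 x
    exact ne_top_of_le_ne_top (EReal.coe_ne_top (n : ℝ)) (iInf₂_le n hn)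

theorem IsGood.rightmost_ne (hG : IsGood G) (h : backwardCluster G 0 ≠ univ) (x : Fin d → ℤ) :
    rightmost G x ≠ ⊥ ∧ rightmost G x ≠ ⊤ := by
  constructor
  · obtain ⟨n, hn⟩ := hG.exists_mem_backwardCluster 0 x
    exact ne_bot_of_le_ne_bot (EReal.coe_ne_bot (n : ℝ))
      (le_iSup₂ (f := fun (k : ℤ) (_ : k ∈ {k : ℤ | x + k • e1 d ∈ backwardCluster G 0}) =>
        ((k : ℝ) : EReal)) n hn)
  · intro htop
    refine h (hG.backwardCluster_eq_univ (y := x) fun n => ?_)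
    by_contra hn
    have hle : rightmost G x ≤ ((n : ℝ) : EReal) := by
      refine iSup₂_le fun k hk => ?_
      by_contra! hlt
      have hkn : n ≤ k := by exact_mod_cast hlt.le
      exact hn (backwardCluster_anti_e1 hG.e1_mem hkn hk)
    rw [htop, top_le_iff] at hle
    exact EReal.coe_ne_top _ hle

end Deterministic

/-! ### Paths -/

section Paths
variable {α : Type*} {R : α → α → Prop}

theorem exists_path_of_reflTransGen {x y : α} (h : Relation.ReflTransGen R x y) :
    ∃ (n : ℕ) (f : ℕ → α), f 0 = x ∧ f n = y ∧ ∀ i < n, R (f i) (f (i + 1)) := by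
  induction h with
  | refl => exact ⟨0, fun _ => x, rfl, rfl, by simp⟩
  | @tail b c _ hbc ih =>
    obtain ⟨n, f, h0, hn, hf⟩ := ih
    refine ⟨n + 1, fun i => if i ≤ n then f i else c, by simpa using h0, by simp, fun i hi => ?_⟩
    rcases (Nat.lt_succ_iff.1 hi).lt_or_eq with hi | rfl
    · simpa [hi.le, Nat.succ_le_of_lt hi] using hf i hi
    · simpa [hn] using hbc

theorem reflTransGen_of_path {n : ℕ} {f : ℕ → α} (hf : ∀ i < n, R (f i) (f (i + 1))) :
    Relation.ReflTransGen R (f 0) (f n) := by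
  induction n with
  | zero => exact .refl
  | succ n ih => exact (ih fun i hi => hf i (by lia)).tail (hf n (by lia))

/-- A path of minimal length visits no vertex twice. -/
theorem exists_injOn_path_of_reflTransGen {x y : α} (h : Relation.ReflTransGen R x y) :
    ∃ (n : ℕ) (f : ℕ → α), f 0 = x ∧ f n = y ∧ (∀ i < n, R (f i) (f (i + 1))) ∧
      InjOn f (Iic n) := by
  classical
  have hex := exists_path_of_reflTransGen h
  obtain ⟨f, h0, hn, hf⟩ := Nat.find_spec hex
  refine ⟨Nat.find hex, f, h0, hn, hf, ?_⟩
  have key : ∀ i j, i < j → j ≤ Nat.find hex → f i ≠ f j := by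
    intro i j hij hj heq
    refine Nat.find_min hex (m := Nat.find hex - (j - i)) (by lia)
      ⟨fun k => if k ≤ i then f k else f (k + (j - i)), by simpa using h0, ?_, fun k hk => ?_⟩
    · dsimp only
      split_ifs with hle
      · have h1 : Nat.find hex = j := by lia
        rw [show Nat.find hex - (j - i) = i by lia, heq, ← h1, hn]
      · rw [Nat.sub_add_cancel (by lia), hn]
    · rcases lt_trichotomy k i with hk' | rfl | hk'
      · simpa [hk'.le, Nat.succ_le_of_lt hk'] using hf k (by lia)
      · have := hf j (by lia)
        rw [← heq] at this
        simpa [show k + 1 + (j - k) = j + 1 by lia] using this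
      · have := hf (k + (j - i)) (by lia)
        simpa [show ¬ k ≤ i by lia, show ¬ k + 1 ≤ i by lia,
          show k + 1 + (j - i) = k + (j - i) + 1 by lia] using this
  intro i hi j hj heq
  rcases lt_trichotomy i j with h | h | h
  · exact absurd heq (key i j h hj)
  · exact h
  · exact absurd heq.symm (key j i h hi)

theorem measurableSet_reflTransGen {Ω : Type*} [MeasurableSpace Ω] [Countable α]
    {R : Ω → α → α → Prop} (hR : ∀ x y, MeasurableSet {ω | R ω x y}) (x y : α) :
    MeasurableSet {ω | Relation.ReflTransGen (R ω) x y} := by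
  have hEq : {ω | Relation.ReflTransGen (R ω) x y} =
      ⋃ (n : ℕ) (f : Fin (n + 1) → α) (_ : f 0 = x ∧ f (Fin.last n) = y),
        ⋂ i : Fin n, {ω | R ω (f i.castSucc) (f i.succ)} := by
    ext ω
    simp only [mem_ofPred_eq, mem_iUnion, mem_iInter, exists_prop]
    constructor
    · intro h
      obtain ⟨n, f, h0, hn, hf⟩ := exists_path_of_reflTransGen h
      exact ⟨n, fun i => f i, ⟨h0, hn⟩, fun i => hf i i.2⟩
    · rintro ⟨n, f, ⟨h0, hn⟩, hf⟩
      have := reflTransGen_of_path (R := R ω) (n := n)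
        (f := fun i => if h : i < n + 1 then f ⟨i, h⟩ else x) fun i hi => by
          simpa [hi, Nat.lt_succ_of_lt hi] using hf ⟨i, hi⟩
      rw [← h0, ← hn]
      change Relation.ReflTransGen (R ω) (f 0) (f ⟨n, Nat.lt_succ_self n⟩)
      simpa using this
  rw [hEq]
  exact .iUnion fun n => .iUnion fun f => .iUnion fun _ => .iInter fun i => hR _ _

end Paths

/-! ### Local environments -/

section Environment
variable {d k : ℕ} {E : Fin k → Set (Fin d → ℤ)} {r : Fin k → ℝ} {p : ℝ}
  {u u' : (Fin d → ℤ) → ℝ} {x e : Fin d → ℤ}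

/-- For a probability vector the slots cover `[0, 1)`. -/
theorem exists_inSlot (hr : r ∈ simplex k) {v : ℝ} (h0 : 0 ≤ v) (h1 : v < 1) :
    ∃ i, InSlot r i v := by
  by_contra! hno
  have key : ∀ n (hn : n < k), ∑ j ∈ Finset.Iic (⟨n, hn⟩ : Fin k), r j ≤ v := by
    intro n
    induction n with
    | zero =>
      intro hn
      by_contra! hlt
      refine hno ⟨0, hn⟩ ⟨?_, hlt⟩
      have : Finset.Iio (⟨0, hn⟩ : Fin k) = ∅ := by
        ext j; simp [Fin.lt_def]
      simpa [this] using h0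
    | succ n ih =>
      intro hn
      by_contra! hlt
      refine hno ⟨n + 1, hn⟩ ⟨?_, hlt⟩
      have : Finset.Iio (⟨n + 1, hn⟩ : Fin k) = Finset.Iic ⟨n, by lia⟩ := by
        ext j; simp [Fin.lt_def, Fin.le_def]
      rw [this]
      exact ih _
  obtain ⟨_, hsum⟩ := hr
  rcases k with _ | k
  · simp at hsum
  · have := key k (Nat.lt_succ_self k)
    have hu : Finset.Iic (⟨k, Nat.lt_succ_self k⟩ : Fin (k + 1)) = Finset.univ := by
      ext j; simp [Fin.le_def, Nat.lt_succ_iff.1 j.2]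
    rw [hu, hsum] at this
    linarith

theorem InSlot.mem_Ico (hr : r ∈ simplex k) {i : Fin k} {v : ℝ} (h : InSlot r i v) :
    v ∈ Ico (0 : ℝ) 1 := by
  refine ⟨(Finset.sum_nonneg fun j _ => hr.1 j).trans h.1, h.2.trans_le ?_⟩
  rw [← hr.2]
  exact Finset.sum_le_sum_of_subset_of_nonneg (Finset.subset_univ _) fun j _ _ => hr.1 j

theorem one_mem_simplex : (fun _ : Fin 1 => (1 : ℝ)) ∈ simplex 1 := by
  simp [simplex]

theorem posUnits_subset_units : posUnits d ⊆ units d := by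
  rintro _ ⟨i, rfl⟩
  exact ⟨i, Or.inl rfl⟩

theorem units_subset_env (hp : p ≤ u x) (hu : u' x ∈ Ico (0 : ℝ) 1) :
    units d ⊆ env E r p u u' x := by
  intro e he
  obtain ⟨i, hi⟩ := exists_inSlot one_mem_simplex hu.1 hu.2
  exact Or.inr ⟨hp, i, hi, he⟩

theorem env_subset_units (hpos : ⋃ i, E i ⊆ posUnits d) : env E r p u u' x ⊆ units d := by
  rintro e (⟨_, i, _, he⟩ | ⟨_, _, _, he⟩)
  · exact posUnits_subset_units (hpos (mem_iUnion_of_mem i he))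
  · exact he

/-- An arrow in a negative direction needs a site with `p ≤ U`. -/
theorem le_of_mem_env (hpos : ⋃ i, E i ⊆ posUnits d) (he : e ∈ env E r p u u' x)
    (he' : e ∉ posUnits d) : p ≤ u x := by
  obtain ⟨_, i, _, h⟩ | ⟨h, _⟩ := he
  · exact absurd (hpos (mem_iUnion_of_mem i h)) he'
  · exact h

/-- The environments for different values of `p` are coupled monotonically, surely: where
`localEnv` is empty, the value of `U'` lies outside `[0, 1)` and the environment is empty for
every `p`. -/
theorem env_antitone (hr : r ∈ simplex k) (hpos : ⋃ i, E i ⊆ posUnits d) {q : ℝ} (hpq : p ≤ q) :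
    env E r q u u' x ⊆ env E r p u u' x := by
  rintro e (⟨_, i, hi, he⟩ | ⟨hq, i, hi, he⟩)
  · rcases lt_or_ge (u x) p with h | h
    · exact Or.inl ⟨h, i, hi, he⟩
    · exact units_subset_env h (hi.mem_Ico hr)
        (posUnits_subset_units (hpos (mem_iUnion_of_mem i he)))
  · exact Or.inr ⟨hpq.trans hq, i, hi, he⟩

theorem forwardCluster_mono {G H : (Fin d → ℤ) → Set (Fin d → ℤ)} (h : ∀ x, G x ⊆ H x) :
    forwardCluster G x ⊆ forwardCluster H x := fun _ hy =>
  Relation.ReflTransGen.mono (fun _ _ ⟨e, he, hb⟩ => ⟨e, h _ he, hb⟩) _ _ hy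

theorem e1_mem_env [NeZero d] (hr : r ∈ simplex k) (he1 : e1 d ∈ ⋂ i, E i)
    (hu : u' x ∈ Ico (0 : ℝ) 1) : e1 d ∈ env E r p u u' x := by
  rcases lt_or_ge (u x) p with h | h
  · obtain ⟨i, hi⟩ := exists_inSlot hr hu.1 hu.2
    exact Or.inl ⟨h, i, hi, mem_iInter.1 he1 i⟩
  · exact units_subset_env h hu ⟨0, Or.inl rfl⟩

end Environment

/-! ### The canonical field and the zero-one laws -/

section Field
open Measure

/-- The uniform distribution on `(0, 1]`. -/
noncomputable def unif : Measure ℝ := volume.restrict (Ioc 0 1)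

instance : IsProbabilityMeasure unif := ⟨by simp [unif]⟩

theorem unif_Iio_le (p : ℝ) : unif (Iio p) ≤ ENNReal.ofReal p := by
  rw [unif, Measure.restrict_apply measurableSet_Iio]
  calc volume (Iio p ∩ Ioc 0 1) ≤ volume (Ioo 0 p) :=
        measure_mono fun x hx => ⟨hx.2.1, hx.1⟩
    _ = ENNReal.ofReal p := by simp

theorem unif_Ici_le (p : ℝ) : unif (Ici p) ≤ ENNReal.ofReal (1 - p) := by
  rw [unif, Measure.restrict_apply measurableSet_Ici]
  calc volume (Ici p ∩ Ioc 0 1) ≤ volume (Icc p 1) :=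
        measure_mono fun x hx => ⟨hx.1, hx.2.2⟩
    _ = ENNReal.ofReal (1 - p) := by simp

theorem ae_unif_mem_Ico : ∀ᵐ v ∂unif, v ∈ Ico (0 : ℝ) 1 := by
  have h1 : ∀ᵐ v ∂unif, v ∈ Ioc (0 : ℝ) 1 := ae_restrict_mem measurableSet_Ioc
  have h2 : ∀ᵐ v ∂unif, v ≠ 1 := ae_restrict_of_ae (ae_ne volume 1)
  filter_upwards [h1, h2] with v hv hv'
  exact ⟨hv.1.le, lt_of_le_of_ne hv.2 hv'⟩

/-- Realisations of the two families of uniform variables: the left copy of `ℤ^d` carries `U`, the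
right copy carries `U'`. -/
abbrev Realisation (d : ℕ) := (Fin d → ℤ) ⊕ (Fin d → ℤ) → ℝ

/-- The joint law of the two families of uniform variables. -/
noncomputable def fieldMeasure (d : ℕ) : Measure (Realisation d) := infinitePi fun _ => unif

instance (d : ℕ) : IsProbabilityMeasure (fieldMeasure d) := by
  unfold fieldMeasure; infer_instance

/-- The environment as a function of the realisation of the two families. -/
def fieldEnv {d k : ℕ} (E : Fin k → Set (Fin d → ℤ)) (r : Fin k → ℝ) (p : ℝ) (ω : Realisation d) :
    (Fin d → ℤ) → Set (Fin d → ℤ) :=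
  env E r p (fun x => ω (.inl x)) fun x => ω (.inr x)

variable {d k : ℕ} {E : Fin k → Set (Fin d → ℤ)} {r : Fin k → ℝ} {p : ℝ}

/-- Almost sure statements about the canonical field hold for every uniform system. -/
theorem IsUniformSystem.ae_of_field {Ω : Type*} [MeasurableSpace Ω] {P : Measure Ω}
    [IsProbabilityMeasure P] {U U' : (Fin d → ℤ) → Ω → ℝ} (h : IsUniformSystem P U U')
    {Φ : Realisation d → Prop} (hΦ : ∀ᵐ ω ∂fieldMeasure d, Φ ω) :
    ∀ᵐ ω ∂P, Φ (fun i => Sum.elim U U' i ω) := by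
  have hm : ∀ i, Measurable (Sum.elim U U' i) := by
    rintro (x | x)
    exacts [h.measurable_left x, h.measurable_right x]
  have hm' : Measurable fun ω i => Sum.elim U U' i ω := measurable_pi_lambda _ hm
  have hlaw : P.map (fun ω i => Sum.elim U U' i ω) = fieldMeasure d := by
    rw [h.indep.map_fun_eq_infinitePi_map₀ hm'.aemeasurable, fieldMeasure]
    congr 1
    funext i
    rcases i with x | x
    exacts [h.law_left x, h.law_right x]
  rw [← hlaw] at hΦ
  exact ae_of_ae_map hm'.aemeasurable hΦ

theorem fieldMeasure_forall_mem (S : Finset (Fin d → ℤ)) {B : Set ℝ} (hB : MeasurableSet B) :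
    fieldMeasure d {ω | ∀ x ∈ S, ω (.inl x) ∈ B} = unif B ^ S.card := by
  have : {ω : Realisation d | ∀ x ∈ S, ω (.inl x) ∈ B} =
      Set.pi (↑(S.map (Function.Embedding.inl : (Fin d → ℤ) ↪ (Fin d → ℤ) ⊕ (Fin d → ℤ))))
        fun _ => B := by
    ext ω; simp [Set.mem_pi]
  rw [this, fieldMeasure, infinitePi_pi _ fun _ _ => hB]
  simp

theorem ae_exists_le (hp : p < 1) {g : ℕ → Fin d → ℤ} (hg : g.Injective) :
    ∀ᵐ ω ∂fieldMeasure d, ∃ n, p ≤ ω (.inl (g n)) := by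
  have hlt : unif (Iio p) < 1 :=
    (unif_Iio_le p).trans_lt (by simpa using hp)
  rw [ae_iff]
  refine le_antisymm (ge_of_tendsto' (ENNReal.tendsto_pow_atTop_nhds_zero_of_lt_one hlt)
    fun N => ?_) zero_le
  calc fieldMeasure d {ω | ¬∃ n, p ≤ ω (.inl (g n))}
      ≤ fieldMeasure d {ω | ∀ x ∈ (Finset.range N).map ⟨g, hg⟩, ω (.inl x) ∈ Iio p} :=
        measure_mono fun ω hω x hx => by
          obtain ⟨n, _, rfl⟩ := Finset.mem_map.1 hx
          exact not_le.1 fun hle => hω ⟨n, hle⟩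
    _ = unif (Iio p) ^ N := by
        rw [fieldMeasure_forall_mem _ measurableSet_Iio]; simp

theorem ae_forall_mem_Ico : ∀ᵐ ω ∂fieldMeasure d, ∀ x, ω (.inr x) ∈ Ico (0 : ℝ) 1 := by
  rw [ae_all_iff]
  exact fun x => (measurePreserving_eval_infinitePi (fun _ => unif)
    (Sum.inr x)).quasiMeasurePreserving.ae ae_unif_mem_Ico

theorem measurableSet_mem_fieldEnv (x e : Fin d → ℤ) :
    MeasurableSet {ω | e ∈ fieldEnv E r p ω x} := by
  have hs : ∀ {l : ℕ} (q : Fin l → ℝ) (i : Fin l),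
      MeasurableSet {ω : Realisation d | InSlot q i (ω (.inr x))} := fun q i =>
    (measurableSet_le measurable_const (measurable_pi_apply _)).inter
      (measurableSet_lt (measurable_pi_apply _) measurable_const)
  have hE : ∀ {l : ℕ} (q : Fin l → ℝ) (F : Fin l → Set (Fin d → ℤ)),
      MeasurableSet {ω : Realisation d | ∃ i, InSlot q i (ω (.inr x)) ∧ e ∈ F i} := by
    intro l q F
    rw [ofPred_exists]
    exact .iUnion fun i => (hs q i).inter (.const _)
  exact ((measurableSet_lt (measurable_pi_apply _) measurable_const).inter (hE _ _)).union
    ((measurableSet_le measurable_const (measurable_pi_apply _)).inter (hE _ _))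

theorem measurableSet_mem_forwardCluster (x y : Fin d → ℤ) :
    MeasurableSet {ω | y ∈ forwardCluster (fieldEnv E r p ω) x} := by
  refine measurableSet_reflTransGen (fun a b => ?_) x y
  have : {ω : Realisation d | ∃ e ∈ fieldEnv E r p ω a, b = a + e} =
      {ω | b - a ∈ fieldEnv E r p ω a} := by
    ext ω
    constructor
    · rintro ⟨e, he, rfl⟩
      simpa using he
    · exact fun h => ⟨b - a, h, by simp⟩
  rw [this]
  exact measurableSet_mem_fieldEnv _ _

theorem measurableSet_forwardCluster_eq_univ (x : Fin d → ℤ) :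
    MeasurableSet {ω | forwardCluster (fieldEnv E r p ω) x = univ} := by
  simp only [eq_univ_iff_forall, ofPred_forall]
  exact .iInter fun y => measurableSet_mem_forwardCluster _ _

theorem measurableSet_backwardCluster_eq_univ (x : Fin d → ℤ) :
    MeasurableSet {ω | backwardCluster (fieldEnv E r p ω) x = univ} := by
  simp only [eq_univ_iff_forall, ofPred_forall]
  exact .iInter fun y => measurableSet_mem_forwardCluster y x

/-- Translation by `a` of both copies of `ℤ^d`. -/
def translate (a : Fin d → ℤ) : Equiv.Perm ((Fin d → ℤ) ⊕ (Fin d → ℤ)) :=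
  Equiv.sumCongr (Equiv.addRight a) (Equiv.addRight a)

theorem mem_forwardCluster_translate (G : (Fin d → ℤ) → Set (Fin d → ℤ)) (a x y : Fin d → ℤ) :
    y ∈ forwardCluster (fun z => G (z + a)) x ↔ y + a ∈ forwardCluster G (x + a) := by
  constructor
  · intro h
    refine Relation.ReflTransGen.lift (· + a) ?_ _ _ h
    rintro b c ⟨e, he, rfl⟩
    exact ⟨e, he, add_right_comm _ _ _⟩
  · intro h
    have := Relation.ReflTransGen.lift
      (p := fun b c => ∃ e ∈ G (b + a), c = b + e) (· - a) ?_ _ _ h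
    · simp only [Function.onFun, add_sub_cancel_right] at this
      exact this
    rintro b c ⟨e, he, rfl⟩
    exact ⟨e, by simpa using he, add_sub_right_comm _ _ _⟩

theorem forwardCluster_translate_eq_univ (G : (Fin d → ℤ) → Set (Fin d → ℤ)) (a : Fin d → ℤ) :
    forwardCluster (fun z => G (z + a)) 0 = univ ↔ forwardCluster G a = univ := by
  simp only [eq_univ_iff_forall, mem_forwardCluster_translate, zero_add]
  exact ⟨fun h y => by simpa using h (y - a), fun h y => h _⟩

theorem backwardCluster_translate_eq_univ (G : (Fin d → ℤ) → Set (Fin d → ℤ)) (a : Fin d → ℤ) :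
    backwardCluster (fun z => G (z + a)) 0 = univ ↔ backwardCluster G a = univ := by
  simp only [eq_univ_iff_forall, backwardCluster, mem_ofPred_eq, mem_forwardCluster_translate,
    zero_add]
  exact ⟨fun h y => by simpa using h (y - a), fun h y => h _⟩

/-- The forward clusters are almost surely everything if and only if the backward clusters are:
both say that almost surely every vertex can be reached from every other one. -/
theorem ae_forwardCluster_iff_backwardCluster :
    (∀ᵐ ω ∂fieldMeasure d, forwardCluster (fieldEnv E r p ω) 0 = univ) ↔
      ∀ᵐ ω ∂fieldMeasure d, backwardCluster (fieldEnv E r p ω) 0 = univ := by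
  have hq := fun a : Fin d → ℤ =>
    (measurePreserving_comp_perm unif (translate a)).quasiMeasurePreserving
  constructor
  · intro h
    have : ∀ᵐ ω ∂fieldMeasure d, ∀ a, forwardCluster (fieldEnv E r p ω) a = univ := by
      rw [ae_all_iff]
      intro a
      filter_upwards [(hq a).ae h] with ω hω
      exact (forwardCluster_translate_eq_univ (fieldEnv E r p ω) a).1 hω
    filter_upwards [this] with ω hω
    refine eq_univ_of_forall fun y => ?_
    have h0 : (0 : Fin d → ℤ) ∈ forwardCluster (fieldEnv E r p ω) y := hω y ▸ mem_univ _
    exact h0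
  · intro h
    have : ∀ᵐ ω ∂fieldMeasure d, ∀ a, backwardCluster (fieldEnv E r p ω) a = univ := by
      rw [ae_all_iff]
      intro a
      filter_upwards [(hq a).ae h] with ω hω
      exact (backwardCluster_translate_eq_univ (fieldEnv E r p ω) a).1 hω
    filter_upwards [this] with ω hω
    refine eq_univ_of_forall fun y => ?_
    have h0 : (0 : Fin d → ℤ) ∈ backwardCluster (fieldEnv E r p ω) y := hω y ▸ mem_univ _
    exact h0

variable [NeZero d]

theorem smul_e1_injective : Function.Injective fun n : ℤ => n • e1 d := by
  intro m n h
  simpa [e1] using congrFun h 0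

theorem ae_isGood (hr : r ∈ simplex k) (he1 : e1 d ∈ ⋂ i, E i) (hp : p < 1) :
    ∀ᵐ ω ∂fieldMeasure d, IsGood (fieldEnv E r p ω) := by
  have hright : ∀ᵐ ω ∂fieldMeasure d, ∀ x, ∃ n : ℕ, p ≤ ω (.inl (x + (n : ℤ) • e1 d)) :=
    ae_all_iff.2 fun x => ae_exists_le hp fun m n h => by
      exact_mod_cast smul_e1_injective (add_left_cancel h)
  have hleft : ∀ᵐ ω ∂fieldMeasure d, ∀ x, ∃ n : ℕ, p ≤ ω (.inl (x - (n : ℤ) • e1 d)) :=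
    ae_all_iff.2 fun x => ae_exists_le hp fun m n h => by
      exact_mod_cast smul_e1_injective (sub_right_injective h)
  filter_upwards [ae_forall_mem_Ico, hright, hleft] with ω h hR hL
  exact
    { e1_mem := fun x => e1_mem_env hr he1 (h x)
      exists_right := fun x => (hR x).imp fun n hn => units_subset_env hn (h _)
      exists_left := fun x => (hL x).imp fun n hn => units_subset_env hn (h _) }

theorem ergodic_translate_e1 :
    Ergodic (fun (ω : Realisation d) i => ω (translate (e1 d) i)) (fieldMeasure d) := by
  refine ergodic_comp_perm unif _ fun I => ?_
  let φ : (Fin d → ℤ) ⊕ (Fin d → ℤ) → ℤ := Sum.elim (fun x => x 0) fun x => x 0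
  have hφ : ∀ (n : ℕ) i, φ ((translate (e1 d) ^ n) i) = φ i + n := by
    intro n
    induction n with
    | zero => simp
    | succ n ih =>
      intro i
      rw [pow_succ, Equiv.Perm.mul_apply, ih]
      rcases i with x | x <;> simp [φ, translate, e1] <;> ring
  refine ⟨(2 * ∑ i ∈ I, (φ i).natAbs) + 1, fun i hi hi' => ?_⟩
  have h1 := Finset.single_le_sum (f := fun i => (φ i).natAbs) (fun _ _ => Nat.zero_le _) hi
  have h2 := Finset.single_le_sum (f := fun i => (φ i).natAbs) (fun _ _ => Nat.zero_le _) hi'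
  have h3 := hφ ((2 * ∑ i ∈ I, (φ i).natAbs) + 1) i
  lia

theorem forwardCluster_zero_one (hr : r ∈ simplex k) (he1 : e1 d ∈ ⋂ i, E i) (hp : p < 1) :
    (∀ᵐ ω ∂fieldMeasure d, forwardCluster (fieldEnv E r p ω) 0 ≠ univ) ∨
      ∀ᵐ ω ∂fieldMeasure d, forwardCluster (fieldEnv E r p ω) 0 = univ := by
  -- the cluster of `0` contains the cluster of `e₁`
  have := ergodic_translate_e1.ae_empty_or_univ_of_preimage_ae_le
    (measurableSet_forwardCluster_eq_univ (E := E) (r := r) (p := p) 0).nullMeasurableSet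
    (by
      filter_upwards [ae_isGood hr he1 hp] with ω hG hω
      have hω' := (forwardCluster_translate_eq_univ (fieldEnv E r p ω) (e1 d)).1 hω
      refine eq_univ_of_forall fun y => ?_
      have hy : y ∈ forwardCluster (fieldEnv E r p ω) (e1 d) := hω' ▸ mem_univ y
      exact Relation.ReflTransGen.head ⟨e1 d, hG.e1_mem 0, (zero_add _).symm⟩ hy)
  simpa [ae_eq_empty, ae_eq_univ, ae_iff, compl_def] using this

theorem backwardCluster_zero_one (hr : r ∈ simplex k) (he1 : e1 d ∈ ⋂ i, E i) (hp : p < 1) :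
    (∀ᵐ ω ∂fieldMeasure d, backwardCluster (fieldEnv E r p ω) 0 ≠ univ) ∨
      ∀ᵐ ω ∂fieldMeasure d, backwardCluster (fieldEnv E r p ω) 0 = univ := by
  -- the backward cluster of `e₁` contains that of `0`
  have := ergodic_translate_e1.ae_empty_or_univ_of_ae_le_preimage
    (measurableSet_backwardCluster_eq_univ (E := E) (r := r) (p := p) 0).nullMeasurableSet
    (by
      filter_upwards [ae_isGood hr he1 hp] with ω hG hω
      refine (backwardCluster_translate_eq_univ (fieldEnv E r p ω) (e1 d)).2 ?_
      refine eq_univ_of_forall fun y => ?_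
      have hω' : backwardCluster (fieldEnv E r p ω) 0 = univ := hω
      have hy : y ∈ backwardCluster (fieldEnv E r p ω) 0 := hω' ▸ mem_univ y
      exact Relation.ReflTransGen.tail hy ⟨e1 d, hG.e1_mem 0, (zero_add _).symm⟩)
  simpa [ae_eq_empty, ae_eq_univ, ae_iff, compl_def] using this

end Field

/-! ### Self-avoiding paths: the critical point is below one -/

section SelfAvoiding
variable {d k : ℕ} {E : Fin k → Set (Fin d → ℤ)} {r : Fin k → ℝ} {p : ℝ}

/-- The unit vector with the given direction; `true` stands for the positive sign. -/
def stepVec (s : Fin d × Bool) : Fin d → ℤ :=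
  if s.2 then Pi.single s.1 1 else -Pi.single s.1 1

/-- The position after `i` steps of the walk from the origin with steps `δ`. -/
def walkPos {n : ℕ} (δ : Fin n → Fin d × Bool) (i : ℕ) : Fin d → ℤ :=
  ∑ j : Fin n, if (j : ℕ) < i then stepVec (δ j) else 0

theorem walkPos_zero {n : ℕ} (δ : Fin n → Fin d × Bool) : walkPos δ 0 = 0 := by
  simp [walkPos]

theorem walkPos_succ {n : ℕ} (δ : Fin n → Fin d × Bool) (i : Fin n) :
    walkPos δ (i + 1) = walkPos δ i + stepVec (δ i) := by
  have : ∀ j : Fin n, (if (j : ℕ) < i + 1 then stepVec (δ j) else 0) =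
      (if (j : ℕ) < i then stepVec (δ j) else 0) + if j = i then stepVec (δ j) else 0 := by
    intro j
    rcases lt_trichotomy j i with h | rfl | h
    · simp [Fin.lt_def.1 h, Nat.lt_succ_of_lt (Fin.lt_def.1 h), h.ne]
    · simp
    · have h' := Fin.lt_def.1 h
      simp [h.ne', show ¬ (j : ℕ) < i by lia, show ¬ (j : ℕ) ≤ i by lia]
  simp_rw [walkPos, this, Finset.sum_add_distrib]
  simp

theorem exists_stepVec {e : Fin d → ℤ} (he : e ∈ units d) : ∃ s, e = stepVec s := by
  obtain ⟨i, rfl | rfl⟩ := he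
  exacts [⟨(i, true), rfl⟩, ⟨(i, false), rfl⟩]

theorem sum_stepVec (s : Fin d × Bool) : ∑ c, stepVec s c = if s.2 then 1 else -1 := by
  unfold stepVec
  split_ifs <;> simp

theorem stepVec_notMem_posUnits {s : Fin d × Bool} (hs : s.2 = false) :
    stepVec s ∉ posUnits d := by
  rintro ⟨i, hi⟩
  have h := sum_stepVec s
  rw [hi] at h
  simp [hs] at h

theorem exists_walk_of_mem_forwardCluster {G : (Fin d → ℤ) → Set (Fin d → ℤ)}
    (hG : ∀ x, G x ⊆ units d) {y : Fin d → ℤ} (hy : y ∈ forwardCluster G 0) :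
    ∃ (n : ℕ) (δ : Fin n → Fin d × Bool), InjOn (walkPos δ) (Iic n) ∧ walkPos δ n = y ∧
      ∀ j : Fin n, stepVec (δ j) ∈ G (walkPos δ j) := by
  obtain ⟨n, f, h0, hn, hf, hinj⟩ := exists_injOn_path_of_reflTransGen hy
  have hstep : ∀ j : Fin n, ∃ s, f (j + 1) = f j + stepVec s ∧ stepVec s ∈ G (f j) := by
    intro j
    obtain ⟨e, he, hj⟩ := hf j j.2
    obtain ⟨s, rfl⟩ := exists_stepVec (hG _ he)
    exact ⟨s, hj, he⟩
  choose δ hδ hδ' using hstep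
  have hpos : ∀ i ≤ n, walkPos δ i = f i := by
    intro i
    induction i with
    | zero => intro _; rw [walkPos_zero, h0]
    | succ i ih =>
      intro hi
      rw [walkPos_succ δ ⟨i, hi⟩, hδ ⟨i, hi⟩, ih (by lia)]
  refine ⟨n, δ, fun i hi j hj h => hinj hi hj ?_, (hpos n le_rfl).trans hn, fun j => ?_⟩
  · rwa [hpos i hi, hpos j hj] at h
  · rw [hpos j j.2.le]; exact hδ' j

/-- The indices of the steps of a walk that go in a negative direction. -/
def negSteps {n : ℕ} (δ : Fin n → Fin d × Bool) : Finset (Fin n) :=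
  Finset.univ.filter fun j => (δ j).2 = false

theorem two_mul_card_negSteps [NeZero d] {n : ℕ} {δ : Fin n → Fin d × Bool}
    (h : walkPos δ n = -e1 d) : 2 * (negSteps δ).card = n + 1 := by
  have h1 : ∑ c, walkPos δ n c = ∑ j : Fin n, if (δ j).2 then (1 : ℤ) else -1 := by
    simp only [walkPos, Fin.is_lt, if_true, Finset.sum_apply]
    rw [Finset.sum_comm]
    exact Finset.sum_congr rfl fun j _ => sum_stepVec _
  have h2 : ∑ j : Fin n, (if (δ j).2 then (1 : ℤ) else -1) = n - 2 * (negSteps δ).card := by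
    have : ∀ j, (if (δ j).2 then (1 : ℤ) else -1) = 1 - 2 * if (δ j).2 = false then 1 else 0 := by
      intro j; cases (δ j).2 <;> simp
    simp only [this, Finset.sum_sub_distrib, ← Finset.mul_sum]
    simp [negSteps]
  rw [h, h2] at h1
  simp [e1] at h1
  lia

theorem measure_negSteps_le {n : ℕ} {δ : Fin n → Fin d × Bool}
    (hδ : InjOn (walkPos δ) (Iic n)) :
    fieldMeasure d {ω | ∀ j ∈ negSteps δ, p ≤ ω (.inl (walkPos δ j))} ≤
      ENNReal.ofReal (1 - p) ^ (negSteps δ).card := by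
  classical
  have hcard : ((negSteps δ).image fun j : Fin n => walkPos δ j).card = (negSteps δ).card :=
    Finset.card_image_of_injective _ fun i j h => Fin.ext (hδ i.2.le j.2.le h)
  have := fieldMeasure_forall_mem ((negSteps δ).image fun j : Fin n => walkPos δ j)
    (measurableSet_Ici (a := p))
  rw [hcard] at this
  simp only [Finset.forall_mem_image, mem_Ici] at this
  rw [this]
  gcongr
  exact unif_Ici_le p

/-- If `1 - p` is small, then `-e₁` may fail to be in the forward cluster of the origin: a
self-avoiding path of length `n` to `-e₁` has `(n + 1) / 2` negative steps, each of which needs a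
site with `p ≤ U`. -/
theorem exists_not_ae_forwardCluster_eq_univ [NeZero d] (hpos : ⋃ i, E i ⊆ posUnits d) :
    ∃ p : ℝ, 0 ≤ p ∧ p < 1 ∧
      ¬ ∀ᵐ ω ∂fieldMeasure d, forwardCluster (fieldEnv E r p ω) 0 = univ := by
  have hd : (1 : ℝ) ≤ d := by exact_mod_cast Nat.one_le_iff_ne_zero.2 (NeZero.ne d)
  -- with `1 - p = t ^ 2`, the expected number of such paths is at most `∑ n, (2 d) ^ n t ^ (n + 1)`
  set t : ℝ := (4 * d)⁻¹ with ht
  have ht0 : 0 < t := by positivity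
  have ht1 : t ≤ 1 / 4 := by
    rw [ht, inv_le_comm₀ (by positivity) (by norm_num)]; linarith
  refine ⟨1 - t ^ 2, by nlinarith, by nlinarith, fun hae => ?_⟩
  set τ := ENNReal.ofReal t
  have hτ : (2 * d : ENNReal) * τ = 2⁻¹ := by
    have : (2 * d : ENNReal) = ENNReal.ofReal (2 * d) := by
      rw [ENNReal.ofReal_mul (by norm_num)]; simp
    rw [this, ← ENNReal.ofReal_mul (by positivity), ht]
    rw [show 2 * (d : ℝ) * (4 * (d : ℝ))⁻¹ = 2⁻¹ by field_simp; norm_num]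
    rw [ENNReal.ofReal_inv_of_pos (by norm_num)]; simp
  let W : (n : ℕ) → (Fin n → Fin d × Bool) → Set (Realisation d) := fun n δ =>
    {ω | (InjOn (walkPos δ) (Iic n) ∧ walkPos δ n = -e1 d) ∧
      ∀ j ∈ negSteps δ, 1 - t ^ 2 ≤ ω (.inl (walkPos δ j))}
  have hW : ∀ n δ, fieldMeasure d (W n δ) ≤ τ ^ (n + 1) := by
    intro n δ
    by_cases hδ : InjOn (walkPos δ) (Iic n) ∧ walkPos δ n = -e1 d
    · refine (measure_mono fun ω hω => hω.2).trans ((measure_negSteps_le hδ.1).trans ?_)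
      rw [sub_sub_cancel, ENNReal.ofReal_pow ht0.le, ← pow_mul, two_mul_card_negSteps hδ.2]
    · rw [show W n δ = ∅ from eq_empty_of_forall_notMem fun ω hω => hδ hω.1]
      simp
  have hone : (1 : ENNReal) ≤ ∑' n : ℕ, ∑ _ : Fin n → Fin d × Bool, τ ^ (n + 1) := by
    calc (1 : ENNReal) = fieldMeasure d univ := measure_univ.symm
      _ ≤ fieldMeasure d (⋃ n, ⋃ δ, W n δ) := by
        refine measure_mono_ae ?_
        filter_upwards [hae] with ω hω _
        have hmem : -e1 d ∈ forwardCluster (fieldEnv E r (1 - t ^ 2) ω) 0 := hω ▸ mem_univ _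
        obtain ⟨n, δ, hinj, hn, hstep⟩ :=
          exists_walk_of_mem_forwardCluster (fun x => env_subset_units hpos) hmem
        refine mem_iUnion₂.2 ⟨n, δ, ⟨hinj, hn⟩, fun j hj => ?_⟩
        exact le_of_mem_env hpos (hstep j)
          (stepVec_notMem_posUnits (Finset.mem_filter.1 hj).2)
      _ ≤ ∑' n, fieldMeasure d (⋃ δ, W n δ) := measure_iUnion_le _
      _ ≤ ∑' n : ℕ, ∑ _ : Fin n → Fin d × Bool, τ ^ (n + 1) :=
        ENNReal.tsum_le_tsum fun n => (measure_iUnion_fintype_le _ _).trans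
          (Finset.sum_le_sum fun δ _ => hW n δ)
  have hsum : ∑' n : ℕ, ∑ _ : Fin n → Fin d × Bool, τ ^ (n + 1) = τ * 2 := by
    rw [← ENNReal.tsum_geometric_two, ← ENNReal.tsum_mul_left]
    congr 1
    funext n
    rw [Finset.sum_const, Finset.card_univ, ← hτ]
    simp only [Fintype.card_fun, Fintype.card_prod, Fintype.card_fin, Fintype.card_bool,
      nsmul_eq_mul]
    push_cast
    ring
  rw [hsum] at hone
  have : τ * 2 < 1 := by
    calc τ * 2 = ENNReal.ofReal (t * 2) := by rw [ENNReal.ofReal_mul ht0.le]; simp [τ]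
      _ < 1 := by rw [ENNReal.ofReal_lt_one]; linarith
  exact absurd hone (not_le.2 this)

end SelfAvoiding

/-! ### Profiles: the critical point is positive -/

section Profile

theorem tsum_pi_prod_fin {β : Type*} (f : β → ENNReal) (m : ℕ) :
    ∑' δ : Fin m → β, ∏ i, f (δ i) = (∑' b, f b) ^ m := by
  induction m with
  | zero => simp
  | succ m ih =>
    rw [← (Fin.consEquiv fun _ : Fin (m + 1) => β).tsum_eq, ENNReal.tsum_prod']
    simp [Fin.consEquiv, Fin.prod_univ_succ, ENNReal.tsum_mul_left, ih, ENNReal.tsum_mul_right,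
      pow_succ']

theorem tsum_int_pow_natAbs_lt_one : ∑' z : ℤ, (4⁻¹ : ENNReal) ^ (1 + z.natAbs) < 1 := by
  have h2 : ∑' n : ℕ, (4⁻¹ : ENNReal) ^ n ≤ 2 := by
    rw [← ENNReal.tsum_geometric_two]
    refine ENNReal.tsum_le_tsum fun n => ?_
    gcongr
    norm_num
  have h1 : ∑' z : ℤ, (4⁻¹ : ENNReal) ^ (1 + z.natAbs) =
      (4⁻¹ + 4⁻¹ ^ 2) * ∑' n : ℕ, (4⁻¹ : ENNReal) ^ n := by
    rw [tsum_of_nat_of_neg_add_one ENNReal.summable ENNReal.summable,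
      add_mul, ← ENNReal.tsum_mul_left, ← ENNReal.tsum_mul_left]
    congr 2 <;> funext n
    · rw [Int.natAbs_natCast, pow_add, pow_one]
    · rw [show (-((n : ℤ) + 1)).natAbs = n + 1 by lia]
      ring
  rw [h1]
  refine (mul_le_mul_right h2 _).trans_lt ?_
  have : (4⁻¹ + 4⁻¹ ^ 2 : ENNReal) * 2 = ENNReal.ofReal (5 / 8) := by
    rw [show (4⁻¹ : ENNReal) = ENNReal.ofReal 4⁻¹ by
        rw [ENNReal.ofReal_inv_of_pos (by norm_num)]; simp,
      show (2 : ENNReal) = ENNReal.ofReal 2 by simp, ← ENNReal.ofReal_pow (by norm_num),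
      ← ENNReal.ofReal_add (by norm_num) (by norm_num), ← ENNReal.ofReal_mul (by norm_num)]
    norm_num
  rw [this, ENNReal.ofReal_lt_one]
  norm_num

variable {d k : ℕ} [NeZero d] {E : Fin k → Set (Fin d → ℤ)} {r : Fin k → ℝ} {p : ℝ}

/-- The vertex `n e₁ + y e₂`. -/
def planeSite (hd : 2 ≤ d) (y : ℕ) (n : ℤ) : Fin d → ℤ :=
  (y : ℤ) • Pi.single (⟨1, hd⟩ : Fin d) 1 + n • e1 d

theorem planeSite_inj (hd : 2 ≤ d) {y y' : ℕ} {n n' : ℤ}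
    (h : planeSite hd y n = planeSite hd y' n') : y = y' ∧ n = n' := by
  have hne : (⟨1, hd⟩ : Fin d) ≠ 0 := by simp [Fin.ext_iff]
  have h0 := congrFun h 0
  have h1 := congrFun h ⟨1, hd⟩
  simp [planeSite, e1, hne, hne.symm] at h0 h1
  exact ⟨h1, h0⟩

/-- If the forward cluster of the origin is not everything, then let `L y` be the leftmost point of
its intersection with row `y` of the plane spanned by `e₁` and `e₂`. In row `y` no site of the
cluster to the left of `L (y + 1)` or `L (y - 1)` may carry all arrows, and neither may the
leftmost one. -/
theorem IsGood.exists_profile {G : (Fin d → ℤ) → Set (Fin d → ℤ)} (hd : 2 ≤ d) (hG : IsGood G)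
    (h : forwardCluster G 0 ≠ univ) :
    ∃ L : ℕ → ℤ, ∀ y n, L y ≤ n → (n = L y ∨ n < L (y + 1) ∨ ∃ y', y = y' + 1 ∧ n < L y') →
      ¬ units d ⊆ G (planeSite hd y n) := by
  have hL : ∀ y : ℕ, ∃ l : ℤ, planeSite hd y l ∈ forwardCluster G 0 ∧
      ∀ n, planeSite hd y n ∈ forwardCluster G 0 → l ≤ n := by
    intro y
    refine Int.exists_least_of_bdd ?_ (hG.exists_mem_forwardCluster 0 _)
    by_contra! hno
    refine h (hG.forwardCluster_eq_univ (y := (y : ℤ) • Pi.single ⟨1, hd⟩ 1) fun n => ?_)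
    obtain ⟨m, hm, hmn⟩ := hno n
    exact forwardCluster_mono_e1 hG.e1_mem hmn.le hm
  choose L hmem hle using hL
  refine ⟨L, fun y n hn hcase hfull => ?_⟩
  have hy : planeSite hd y n ∈ forwardCluster G 0 := forwardCluster_mono_e1 hG.e1_mem hn (hmem y)
  rcases hcase with rfl | hlt | ⟨y, rfl, hlt⟩
  · have hmem' := add_mem_forwardCluster hy (hfull ⟨0, Or.inr rfl⟩)
    have : planeSite hd y (L y) + -Pi.single 0 1 = planeSite hd y (L y - 1) := by
      simp only [planeSite, e1, sub_smul, one_smul]; abel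
    rw [this] at hmem'
    have := hle y _ hmem'
    lia
  · have hmem' := add_mem_forwardCluster hy (hfull ⟨⟨1, hd⟩, Or.inl rfl⟩)
    have : planeSite hd y n + Pi.single ⟨1, hd⟩ 1 = planeSite hd (y + 1) n := by
      simp only [planeSite, Nat.cast_add, Nat.cast_one, add_smul, one_smul]; abel
    rw [this] at hmem'
    exact absurd (hle _ _ hmem') (not_le.2 hlt)
  · have hmem' := add_mem_forwardCluster hy (hfull ⟨⟨1, hd⟩, Or.inr rfl⟩)
    have : planeSite hd (y + 1) n + -Pi.single ⟨1, hd⟩ 1 = planeSite hd y n := by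
      simp only [planeSite, Nat.cast_add, Nat.cast_one, add_smul, one_smul]; abel
    rw [this] at hmem'
    exact absurd (hle _ _ hmem') (not_le.2 hlt)

/-- The increments of a profile with prescribed increments `δ` between the rows `0, …, m`:
`incr δ y` is the increment from row `y - 1` to row `y`, and it is `0` if one of these rows is not
among `0, …, m`. -/
def incr {m : ℕ} (δ : Fin m → ℤ) : ℕ → ℤ
  | 0 => 0
  | i + 1 => if h : i < m then δ ⟨i, h⟩ else 0

/-- The profile with increments `δ` that starts at `a`. -/
def profile {m : ℕ} (a : ℤ) (δ : Fin m → ℤ) (y : ℕ) : ℤ := a + ∑ i ∈ Finset.range (y + 1), incr δ i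

/-- The number of sites of row `y`, counted from the profile to the right, that cannot carry all
arrows, given the profile. -/
def rowCard {m : ℕ} (δ : Fin m → ℤ) (y : ℕ) : ℕ :=
  (max 1 (max (incr δ (y + 1)) (-incr δ y))).toNat

/-- Each row has at least a third of `1` plus the increase to the next row plus the decrease from
the previous row. -/
theorem sum_natAbs_le_sum_rowCard {m : ℕ} (δ : Fin m → ℤ) :
    ∑ i, (1 + (δ i).natAbs) ≤ 3 * ∑ y ∈ Finset.range (m + 1), rowCard δ y := by
  have hrow : ∀ y, 1 + (incr δ (y + 1)).toNat + (-incr δ y).toNat ≤ 3 * rowCard δ y := by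
    intro y; unfold rowCard; lia
  have hsum : ∑ i, (1 + (δ i).natAbs) = ∑ i ∈ Finset.range m, (1 + (incr δ (i + 1)).natAbs) := by
    rw [Finset.sum_range]
    simp [incr]
  calc ∑ i, (1 + (δ i).natAbs)
      = ∑ i ∈ Finset.range m, (1 + (incr δ (i + 1)).toNat) +
          ∑ i ∈ Finset.range m, (-incr δ (i + 1)).toNat := by
        rw [hsum, ← Finset.sum_add_distrib]
        exact Finset.sum_congr rfl fun i _ => by lia
    _ ≤ ∑ y ∈ Finset.range (m + 1), (1 + (incr δ (y + 1)).toNat) +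
          ∑ y ∈ Finset.range (m + 1), (-incr δ y).toNat := by
        rw [Finset.sum_range_succ, Finset.sum_range_succ' fun y => (-incr δ y).toNat]
        lia
    _ ≤ 3 * ∑ y ∈ Finset.range (m + 1), rowCard δ y := by
        rw [← Finset.sum_add_distrib, Finset.mul_sum]
        exact Finset.sum_le_sum fun y _ => hrow y

/-- The sites of the rows `0, …, m` that cannot carry all arrows, given the profile. -/
noncomputable def profileSites {m : ℕ} (hd : 2 ≤ d) (a : ℤ) (δ : Fin m → ℤ) : Finset (Fin d → ℤ) :=
  ((Finset.range (m + 1)).sigma fun y =>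
    Finset.Ico (profile a δ y) (profile a δ y + rowCard δ y)).map
    ⟨fun s : (_ : ℕ) × ℤ => planeSite hd s.1 s.2, fun s s' h => by
      obtain ⟨h1, h2⟩ := planeSite_inj hd h
      exact Sigma.ext h1 (heq_of_eq h2)⟩

theorem measure_profileSites_le {m : ℕ} (hd : 2 ≤ d) (a : ℤ) (δ : Fin m → ℤ) :
    fieldMeasure d {ω | ∀ x ∈ profileSites hd a δ, ω (.inl x) ∈ Iio (1 / 64)} ≤
      ∏ i, (4⁻¹ : ENNReal) ^ (1 + (δ i).natAbs) := by
  have hcard : (profileSites hd a δ).card = ∑ y ∈ Finset.range (m + 1), rowCard δ y := by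
    simp [profileSites]
  have hp : unif (Iio (1 / 64)) ≤ (4⁻¹ : ENNReal) ^ 3 := by
    refine (unif_Iio_le _).trans_eq ?_
    rw [show (1 / 64 : ℝ) = 4⁻¹ ^ 3 by norm_num, ENNReal.ofReal_pow (by norm_num),
      ENNReal.ofReal_inv_of_pos (by norm_num)]
    simp
  rw [fieldMeasure_forall_mem _ measurableSet_Iio, hcard, Finset.prod_pow_eq_pow_sum]
  calc unif (Iio (1 / 64)) ^ ∑ y ∈ Finset.range (m + 1), rowCard δ y
      ≤ ((4⁻¹ : ENNReal) ^ 3) ^ ∑ y ∈ Finset.range (m + 1), rowCard δ y := by gcongr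
    _ ≤ (4⁻¹ : ENNReal) ^ ∑ i, (1 + (δ i).natAbs) := by
      rw [← pow_mul]
      exact pow_le_pow_of_le_one zero_le (by simp) (sum_natAbs_le_sum_rowCard δ)

theorem profile_eq {m : ℕ} (L : ℕ → ℤ) {y : ℕ} (hy : y ≤ m) :
    profile (L 0) (fun i : Fin m => L (i + 1) - L i) y = L y := by
  rw [profile, Finset.sum_range_succ', incr, add_zero]
  have : ∀ i ∈ Finset.range y, incr (fun i : Fin m => L (i + 1) - L i) (i + 1) =
      L (i + 1) - L i := by
    intro i hi
    have := Finset.mem_range.1 hi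
    simp [incr, show i < m by lia]
  rw [Finset.sum_congr rfl this, Finset.sum_range_sub]
  ring

/-- If `p` is small, then the forward cluster of the origin is almost surely everything: the
probability of a profile with a given starting point and `m` increments, summed over all
possible increments, decays exponentially in `m`. -/
theorem ae_forwardCluster_eq_univ (hd : 2 ≤ d) (hr : r ∈ simplex k) (he1 : e1 d ∈ ⋂ i, E i) :
    ∀ᵐ ω ∂fieldMeasure d, forwardCluster (fieldEnv E r (1 / 64) ω) 0 = univ := by
  have hnull : ∀ a : ℤ, ∀ᵐ ω ∂fieldMeasure d, ¬ ∀ m : ℕ, ∃ δ : Fin m → ℤ,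
      ∀ x ∈ profileSites hd a δ, ω (.inl x) ∈ Iio (1 / 64) := by
    intro a
    simp only [ae_iff, not_not]
    refine le_antisymm (ge_of_tendsto' (ENNReal.tendsto_pow_atTop_nhds_zero_of_lt_one
      tsum_int_pow_natAbs_lt_one) fun m => ?_) zero_le
    rw [← tsum_pi_prod_fin]
    refine le_trans ?_ (ENNReal.tsum_le_tsum fun δ => measure_profileSites_le hd a δ)
    refine (measure_mono fun ω hω => ?_).trans (measure_iUnion_le _)
    exact mem_iUnion.2 (hω m)
  filter_upwards [ae_all_iff.2 hnull, ae_isGood hr he1 (by norm_num : (1 / 64 : ℝ) < 1),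
    ae_forall_mem_Ico] with ω hω hG hu
  by_contra hne
  obtain ⟨L, hL⟩ := hG.exists_profile hd hne
  refine hω (L 0) fun m => ⟨fun i => L (i + 1) - L i, fun x hx => ?_⟩
  obtain ⟨⟨y, n⟩, hyn, rfl⟩ := Finset.mem_map.1 hx
  simp only [Finset.mem_sigma, Finset.mem_range, Finset.mem_Ico, Nat.lt_succ_iff] at hyn
  obtain ⟨hy, hn, hn'⟩ := hyn
  rw [profile_eq L hy] at hn hn'
  refine not_le.1 fun hle => hL y n hn ?_ (units_subset_env hle (hu _))
  by_contra! hcase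
  have h1 : incr (fun i : Fin m => L (i + 1) - L i) (y + 1) ≤ n - L y := by
    rw [incr]
    split_ifs
    · linarith [hcase.2.1]
    · linarith
  have h2 : -incr (fun i : Fin m => L (i + 1) - L i) y ≤ n - L y := by
    rcases y with _ | y
    · simpa [incr] using hn
    · have := hcase.2.2 y rfl
      simp only [incr, show y < m by lia, dif_pos]
      linarith
  have h3 := hcase.1
  unfold rowCard at hn'
  lia

end Profile

end HalfOrthant

/-! ### The critical point -/

theorem theorem3 {d k : ℕ} [NeZero d] (hd : 2 ≤ d)
    (E : Fin k → Set (Fin d → ℤ)) (r : Fin k → ℝ) (hr : r ∈ HalfOrthant.simplex k)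
    (he1 : HalfOrthant.e1 d ∈ ⋂ i, E i) (hpos : ⋃ i, E i ⊆ HalfOrthant.posUnits d) :
    ∃ pc : ℝ, 0 < pc ∧ pc < 1 ∧
      ∀ {Ω : Type*} [MeasurableSpace Ω] (P : Measure Ω) [IsProbabilityMeasure P]
        (U U' : (Fin d → ℤ) → Ω → ℝ), HalfOrthant.IsUniformSystem P U U' →
        -- `pc` is the critical point of the forward cluster
        ((∀ p : ℝ, 0 ≤ p → p < pc → ∀ᵐ ω ∂P,
            HalfOrthant.forwardCluster
              (HalfOrthant.env E r p (fun x => U x ω) (fun x => U' x ω)) 0 = univ) ∧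
          (∀ p : ℝ, pc < p → p < 1 → ∀ᵐ ω ∂P, ∀ x : Fin d → ℤ,
            HalfOrthant.leftmost
                (HalfOrthant.env E r p (fun x => U x ω) (fun x => U' x ω)) x ≠ ⊥ ∧
              HalfOrthant.leftmost
                (HalfOrthant.env E r p (fun x => U x ω) (fun x => U' x ω)) x ≠ ⊤)) ∧
        -- the backward cluster has its phase transition at the same point
        ((∀ p : ℝ, 0 ≤ p → p < pc → ∀ᵐ ω ∂P,
            HalfOrthant.backwardCluster
              (HalfOrthant.env E r p (fun x => U x ω) (fun x => U' x ω)) 0 = univ) ∧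
          (∀ p : ℝ, pc < p → p < 1 → ∀ᵐ ω ∂P, ∀ x : Fin d → ℤ,
            HalfOrthant.rightmost
                (HalfOrthant.env E r p (fun x => U x ω) (fun x => U' x ω)) x ≠ ⊥ ∧
              HalfOrthant.rightmost
                (HalfOrthant.env E r p (fun x => U x ω) (fun x => U' x ω)) x ≠ ⊤)) := by
  -- the set of parameters for which the forward cluster is almost surely everything
  set S : Set ℝ := {p | (0 ≤ p ∧ p ≤ 1) ∧ ∀ᵐ ω ∂HalfOrthant.fieldMeasure d,
    HalfOrthant.forwardCluster (HalfOrthant.fieldEnv E r p ω) 0 = univ}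
  have hbdd : BddAbove S := ⟨1, fun p hp => hp.1.2⟩
  have hmem : (1 / 64 : ℝ) ∈ S :=
    ⟨by norm_num, HalfOrthant.ae_forwardCluster_eq_univ hd hr he1⟩
  have hdown : ∀ p q : ℝ, 0 ≤ p → p ≤ q → q ∈ S → p ∈ S := fun p q hp hpq hq => by
    refine ⟨⟨hp, hpq.trans hq.1.2⟩, ?_⟩
    filter_upwards [hq.2] with ω hω
    exact univ_subset_iff.1
      (hω ▸ HalfOrthant.forwardCluster_mono fun x => HalfOrthant.env_antitone hr hpos hpq)
  have hbelow : ∀ p : ℝ, 0 ≤ p → p < sSup S → p ∈ S := fun p hp hlt => by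
    obtain ⟨q, hq, hpq⟩ := exists_lt_of_lt_csSup ⟨_, hmem⟩ hlt
    exact hdown p q hp hpq.le hq
  have habove : ∀ p : ℝ, sSup S < p → p < 1 → p ∉ S := fun p hlt _ hp =>
    absurd (le_csSup hbdd hp) (not_le.2 hlt)
  have hpos' : 0 < sSup S := lt_of_lt_of_le (by norm_num) (le_csSup hbdd hmem)
  refine ⟨sSup S, hpos', ?_, ?_⟩
  · obtain ⟨p, hp0, hp1, hp⟩ := HalfOrthant.exists_not_ae_forwardCluster_eq_univ
      (E := E) (r := r) hpos
    refine lt_of_le_of_lt (csSup_le ⟨_, hmem⟩ fun q hq => ?_) hp1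
    by_contra! hlt
    exact hp (hdown p q hp0 hlt.le hq).2
  intro Ω _ P _ U U' hU
  refine ⟨⟨fun p hp hlt => ?_, fun p hlt hp1 => ?_⟩, fun p hp hlt => ?_, fun p hlt hp1 => ?_⟩
  · exact hU.ae_of_field (hbelow p hp hlt).2
  · have h0 : 0 ≤ p := (hpos'.trans hlt).le
    have hne := (HalfOrthant.forwardCluster_zero_one hr he1 hp1).resolve_right
      fun h => habove p hlt hp1 ⟨⟨h0, hp1.le⟩, h⟩
    refine hU.ae_of_field (Φ := fun ω => ∀ x : Fin d → ℤ,
      HalfOrthant.leftmost (HalfOrthant.fieldEnv E r p ω) x ≠ ⊥ ∧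
        HalfOrthant.leftmost (HalfOrthant.fieldEnv E r p ω) x ≠ ⊤) ?_
    filter_upwards [HalfOrthant.ae_isGood hr he1 hp1, hne] with ω hG hω x
    exact hG.leftmost_ne hω x
  · exact hU.ae_of_field
      (HalfOrthant.ae_forwardCluster_iff_backwardCluster.1 (hbelow p hp hlt).2)
  · have h0 : 0 ≤ p := (hpos'.trans hlt).le
    have hne := (HalfOrthant.backwardCluster_zero_one hr he1 hp1).resolve_right fun h =>
      habove p hlt hp1
        ⟨⟨h0, hp1.le⟩, HalfOrthant.ae_forwardCluster_iff_backwardCluster.2 h⟩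
    refine hU.ae_of_field (Φ := fun ω => ∀ x : Fin d → ℤ,
      HalfOrthant.rightmost (HalfOrthant.fieldEnv E r p ω) x ≠ ⊥ ∧
        HalfOrthant.rightmost (HalfOrthant.fieldEnv E r p ω) x ≠ ⊤) ?_
    filter_upwards [HalfOrthant.ae_isGood hr he1 hp1, hne] with ω hG hω x
    exact hG.rightmost_ne hω x
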